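/- A partition is a finite multiset of positive integers; its size $|\lambda|$ is the sum of its parts, and it is called proper if none of its parts equals $1$. For $n\ge 0$ let $\mathcal B_n\le \mathcal S_{2n}$ be the subgroup of the permutations that permute the blocks $\{2k-1,2k\}$, $1\le k\le n$. The coset-type of $\omega\in\mathcal S_{2n}$ is the partition of $n$ formed by the half-lengths of the cycles of the graph on $\{1,\dots,2n\}$ in which $i,j$ are joined by an exterior edge when $\{i,j\}$ is a block and by an interior edge when $\{\omega(i),\omega(j)\}$ is a block. The Hecke algebra $\mathbb C[\mathcal B_n\backslash\mathcal S_{2n}/\mathcal B_n]$ consists of the $x\in\mathbb C[\mathcal S_{2n}]$ with $bxb'^{-1}=x$ for all $b,b'\in\mathcal B_n$. For a proper partition $\lambda$ let $K_\lambda(n)$ be the sum of all $\omega\in\mathcal S_{2n}$ of coset-type $\lambda\cup(1^{n-|\lambda|})$ (so $K_\lambda(n)=0$ if $n<|\lambda|$). The elements $K_\rho(n)$, for $\rho$ a proper partition with $|\rho|\le n$, form a basis of $\mathbb C[\mathcal B_n\backslash\mathcal S_{2n}/\mathcal B_n]$. For proper partitions $\lambda,\delta,\rho$, let $\alpha_{\lambda\delta}^{\rho}(n)$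 be the coefficient of $K_\rho(n)$ in $K_\lambda(n)\cdot K_\delta(n)$ with respect to this basis if $|\rho|\le n$, with the convention $\alpha_{\lambda\delta}^{\rho}(n)=0$ if $|\rho|>n$. **Theorem.** Let $\lambda,\delta,\rho$ be proper partitions. There are non-negative rational numbers $a_j$, depending only on $\lambda,\delta,\rho$ and $j$, such that, with the polynomial $$f_{\lambda\delta}^{\rho}(n)=\sum_{j=0}^{|\lambda|+|\delta|-|\rho|}a_j\,(n-|\rho|)_j,\qquad (m)_j=m(m-1)\cdots(m-j+1)$$ (the sum being empty, so $f_{\lambda\delta}^{\rho}=0$, if $|\rho|>|\lambda|+|\delta|$), one has for every $n\ge 0$ $$\alpha_{\lambda\delta}^{\rho}(n)=\begin{cases}2^n\,n!\,f_{\lambda\delta}^{\rho}(n)&\text{if } n\ge|\rho|,\\ 0&\text{if } n<|\rho|.\end{cases}$$ -/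

import Mathlib

open Equiv Polynomial

/-- A partition (a finite multiset of positive integers) none of whose parts equals `1`. -/
@[ext]
structure ProperPartition where
  parts : Multiset ℕ
  parts_pos : ∀ p ∈ parts, 0 < p
  one_notMem : 1 ∉ parts

namespace ProperPartition

/-- The size of a partition: the sum of its parts. -/
def size (lam : ProperPartition) : ℕ := lam.parts.sum

end ProperPartition

namespace HeckePair

/-- The block `{2k-1, 2k}` of `[2n]`; with `0`-based labels this is `{2k, 2k+1}`. -/
def block (n : ℕ) (k : Fin n) : Set (Fin (2 * n)) := {i | i.val / 2 = k.val}

/-- A permutation that maps every block onto some block. -/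
def MapsBlocks {n : ℕ} (w : Perm (Fin (2 * n))) : Prop :=
  ∀ k : Fin n, ∃ k' : Fin n, w '' block n k = block n k'

theorem div_lt {n : ℕ} (i : Fin (2 * n)) : i.val / 2 < n := by
  have := i.isLt
  omega

theorem MapsBlocks.div_eq_iff {n : ℕ} {w : Perm (Fin (2 * n))} (hw : MapsBlocks w)
    (i j : Fin (2 * n)) : (w i).val / 2 = (w j).val / 2 ↔ i.val / 2 = j.val / 2 := by
  obtain ⟨k', hk'⟩ := hw ⟨i.val / 2, div_lt i⟩
  have key : ∀ x : Fin (2 * n), (w x).val / 2 = k'.val ↔ x.val / 2 = i.val / 2 := by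
    intro x
    have h1 : w x ∈ w '' block n ⟨i.val / 2, div_lt i⟩ ↔ w x ∈ block n k' := by rw [hk']
    rw [w.injective.mem_set_image] at h1
    exact h1.symm
  have hi := (key i).2 rfl
  rw [hi, eq_comm, key j, eq_comm]

theorem mapsBlocks_of_div_eq_iff {n : ℕ} {w : Perm (Fin (2 * n))}
    (hw : ∀ i j : Fin (2 * n), (w i).val / 2 = (w j).val / 2 ↔ i.val / 2 = j.val / 2) :
    MapsBlocks w := by
  intro k
  have hk := k.isLt
  let i : Fin (2 * n) := ⟨2 * k.val, by omega⟩
  have hi : i.val / 2 = k.val := by simp [i]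
  refine ⟨⟨(w i).val / 2, div_lt _⟩, ?_⟩
  ext x
  constructor
  · rintro ⟨y, hy, rfl⟩
    change (w y).val / 2 = (w i).val / 2
    rw [hw, hi]
    exact hy
  · intro hx
    refine ⟨w.symm x, ?_, by simp⟩
    change (w.symm x).val / 2 = k.val
    have hx' : x.val / 2 = (w i).val / 2 := hx
    rw [← hi, ← hw]
    simpa using hx'

/-- The hyperoctahedral subgroup `B_n` of the symmetric group of `[2n]`. -/
def hyperoctahedral (n : ℕ) : Subgroup (Perm (Fin (2 * n))) where
  carrier := {w | MapsBlocks w}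
  one_mem' := fun k => ⟨k, by simp⟩
  mul_mem' := fun {a b} ha hb => mapsBlocks_of_div_eq_iff fun i j => by
    rw [Perm.mul_apply, Perm.mul_apply, ha.div_eq_iff, hb.div_eq_iff]
  inv_mem' := fun {a} ha => mapsBlocks_of_div_eq_iff fun i j => by
    rw [← ha.div_eq_iff]; simp

/-- The graph of a permutation `w` of `[2n]`: vertices are the exterior labels `i`, the interior
label of `i` being `w i`; two distinct vertices are joined if their exterior labels form a block
(exterior edge) or their interior labels form a block (interior edge). Every vertex lies on
exactly one exterior and one interior edge, so every connected component is a cycle of even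
length (a cycle of length two when an exterior and an interior edge coincide). -/
def cosetGraph {n : ℕ} (w : Perm (Fin (2 * n))) : SimpleGraph (Fin (2 * n)) where
  Adj i j := i ≠ j ∧ (i.val / 2 = j.val / 2 ∨ (w i).val / 2 = (w j).val / 2)
  symm := ⟨fun _ _ h => ⟨h.1.symm, h.2.imp Eq.symm Eq.symm⟩⟩
  loopless := ⟨fun _ h => h.1 rfl⟩

open Classical in
/-- The coset-type of `w`: the multiset of half-lengths of the cycles of its graph. -/
noncomputable def cosetType {n : ℕ} (w : Perm (Fin (2 * n))) : Multiset ℕ :=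
  (Finset.univ : Finset (cosetGraph w).ConnectedComponent).val.map fun c => c.supp.ncard / 2

theorem cosetType_mul_mul {n : ℕ} {b b' : Perm (Fin (2 * n))} (hb : b ∈ hyperoctahedral n)
    (hb' : b' ∈ hyperoctahedral n) (w : Perm (Fin (2 * n))) :
    cosetType (b * w * b') = cosetType w := by
  classical
  have hadj : ∀ i j, (cosetGraph w).Adj (b' i) (b' j) ↔ (cosetGraph (b * w * b')).Adj i j := by
    intro i j
    change (_ ∧ (_ ∨ _)) ↔ (_ ∧ (_ ∨ _))
    simp only [Perm.mul_apply]
    rw [MapsBlocks.div_eq_iff hb, MapsBlocks.div_eq_iff hb', b'.injective.ne_iff]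
  let e : cosetGraph (b * w * b') ≃g cosetGraph w := ⟨b', fun {i j} => hadj i j⟩
  unfold cosetType
  have hsupp : ∀ c : (cosetGraph (b * w * b')).ConnectedComponent,
      (e.connectedComponentEquiv c).supp.ncard = c.supp.ncard := by
    intro c
    have : (e.connectedComponentEquiv c).supp = e '' c.supp := by
      ext x
      induction c using SimpleGraph.ConnectedComponent.ind with
      | h v =>
      constructor
      · intro hx
        refine ⟨e.symm x, ?_, by simp⟩
        have h : (cosetGraph w).Reachable x (e v) := SimpleGraph.ConnectedComponent.exact hx
        have h2 := h.map e.symm.toHom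
        apply SimpleGraph.ConnectedComponent.sound
        simpa using h2
      · rintro ⟨y, hy, rfl⟩
        have h : (cosetGraph (b * w * b')).Reachable y v :=
          SimpleGraph.ConnectedComponent.exact hy
        exact SimpleGraph.ConnectedComponent.sound (h.map e.toHom)
    rw [this, Set.ncard_image_of_injective _ e.injective]
  rw [← Finset.map_univ_equiv e.connectedComponentEquiv, Finset.map_val, Multiset.map_map]
  refine Multiset.map_congr rfl fun c _ => ?_
  simp only [Function.comp_apply, Equiv.coe_toEmbedding, hsupp]

/-- The complex group algebra of the symmetric group of `[2n]`. -/
abbrev GroupAlg (n : ℕ) : Type := MonoidAlgebra ℂ (Perm (Fin (2 * n)))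

/-- The Hecke algebra of the pair `(S_{2n}, B_n)`: the elements `x` of the group algebra with
`b x b'⁻¹ = x` for all `b, b'` in `B_n`. It is closed under the product, but it does not contain
the unit of the group algebra in general, hence a non-unital subalgebra. -/
noncomputable def heckeAlgebra (n : ℕ) : NonUnitalSubalgebra ℂ (GroupAlg n) where
  carrier := {x | ∀ b ∈ hyperoctahedral n, ∀ b' ∈ hyperoctahedral n,
    MonoidAlgebra.of ℂ _ b * x * MonoidAlgebra.of ℂ _ b'⁻¹ = x}
  zero_mem' := by
    intro b _ b' _
    simp only [mul_zero, zero_mul]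
  add_mem' := by
    intro x y hx hy b hb b' hb'
    rw [mul_add, add_mul, hx b hb b' hb', hy b hb b' hb']
  smul_mem' := by
    intro c x hx b hb b' hb'
    rw [mul_smul_comm, smul_mul_assoc, hx b hb b' hb']
  mul_mem' := by
    intro x y hx hy b hb b' hb'
    have h1 := hx b hb 1 (one_mem _)
    have h2 := hy 1 (one_mem _) b' hb'
    rw [inv_one, map_one, mul_one] at h1
    rw [map_one, one_mul] at h2
    rw [← mul_assoc, h1, mul_assoc, h2]

open Classical in
/-- The sum, in the group algebra, of all permutations of `[2n]` of coset-type
`λ ∪ (1^{n-|λ|})`. There is no such permutation, and the sum is `0`, if `n < |λ|`. -/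
noncomputable def classSum (lam : ProperPartition) (n : ℕ) : GroupAlg n :=
  ∑ w : Perm (Fin (2 * n)) with
    lam.size ≤ n ∧ cosetType w = lam.parts + Multiset.replicate (n - lam.size) 1,
      MonoidAlgebra.of ℂ _ w

theorem classSum_mem (lam : ProperPartition) (n : ℕ) : classSum lam n ∈ heckeAlgebra n := by
  intro b hb b' hb'
  unfold classSum
  rw [Finset.mul_sum, Finset.sum_mul]
  refine Finset.sum_equiv ((Equiv.mulLeft b).trans (Equiv.mulRight b'⁻¹)) ?_ ?_
  · intro w
    simp only [Finset.mem_filter, Finset.mem_univ, true_and, Equiv.trans_apply,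
      Equiv.coe_mulLeft, Equiv.coe_mulRight, cosetType_mul_mul hb (inv_mem hb')]
  · intro w _
    simp only [Equiv.trans_apply, Equiv.coe_mulLeft, Equiv.coe_mulRight, map_mul]

/-- The element `K_λ(n)` of the Hecke algebra. -/
noncomputable def K (lam : ProperPartition) (n : ℕ) : heckeAlgebra n :=
  ⟨classSum lam n, classSum_mem lam n⟩

/-- The coefficient of the basis vector indexed by `ρ` in `K_λ(n) K_δ(n)`, with respect to a basis
`B` of the Hecke algebra indexed by the proper partitions of size at most `n`; it is `0` if `ρ`
does not index a basis vector, i.e. if `n < |ρ|`. -/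
noncomputable def structureCoeff {n : ℕ}
    (B : Module.Basis {s : ProperPartition // s.size ≤ n} ℂ (heckeAlgebra n))
    (lam del rho : ProperPartition) : ℂ :=
  if h : rho.size ≤ n then B.repr (K lam n * K del n) ⟨rho, h⟩ else 0

end HeckePair

/-! Let `a` be the pairing of `[2n]` given by the blocks, and attach to `w` the pairing `interior w
= w⁻¹ a w`. The group `B_n` is the centralizer of `a`, so `interior` identifies the cosets `B_n w`
with all pairings, each fibre having `2^n n!` elements. A graph component with `2k` vertices splits
into two `k`-cycles of `a * interior w`, exchanged by `a`; hence the coset-type is `λ ∪ (1^{n-|λ|})`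
iff that product has cycle type `2 • λ` (`hasType_iff`).

Fix `w` of type `ρ` and put `b = interior w`. The coefficient of `w` in `K_λ K_δ` counts the `v`
with `v` of type `δ` and `w v⁻¹` of type `λ`. This depends only on `m = interior v`: the cycle types
of `m a` and `m b` must be `2 • δ` and `2 • λ`. So the coefficient is `2^n n!` times a number of
pairings `m` (`ncard_hasType_and_hasType`).

Sort these `m` by the set `u` of blocks on which `m`, `a`, `b` do not all agree. It contains the
`|ρ|` blocks on which `a` and `b` differ, so there are `(n-|ρ|).choose j` choices with `|u| = |ρ| +
j`. Restriction to `u` shows that the number of `m` for a given `u` depends on `ρ`, `λ`, `δ`, `j`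
only (`typeCount`), because pairs of pairings are classified by the cycle type of their product
(`IsPairing.exists_equiv`). It vanishes for `j > |λ| + |δ| - |ρ|`, since each point of `u` is moved
by `m a` or `m b`. Thus `a_j = typeCount / j!`. -/

namespace HeckePair

/-! ### Pairs of perfect matchings and the cycle type of their product. -/

section Pairings

variable {α β : Type*}

/-- A fixed-point-free involution, i.e. a perfect matching of the points. -/
structure IsPairing (m : Perm α) : Prop where
  apply_apply : ∀ x, m (m x) = x
  apply_ne : ∀ x, m x ≠ x

theorem IsPairing.inv_eq {a : Perm α} (ha : IsPairing a) : a⁻¹ = a := by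
  ext x
  rw [Perm.inv_eq_iff_eq, ha.apply_apply]

theorem IsPairing.mul_self {a : Perm α} (ha : IsPairing a) : a * a = 1 := by
  ext x
  simp [ha.apply_apply]

theorem IsPairing.conj {a : Perm α} (ha : IsPairing a) (w : Perm α) :
    IsPairing (w⁻¹ * a * w) where
  apply_apply x := by simp [ha.apply_apply]
  apply_ne x := by
    intro h
    apply ha.apply_ne (w x)
    rwa [Perm.mul_apply, Perm.mul_apply, Perm.inv_eq_iff_eq] at h

theorem IsPairing.permCongr {a : Perm α} (ha : IsPairing a) (e : α ≃ β) :
    IsPairing (e.permCongr a) where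
  apply_apply x := by simp [ha.apply_apply]
  apply_ne x := by
    intro h
    apply ha.apply_ne (e.symm x)
    simpa [Equiv.permCongr_apply, ← Equiv.eq_symm_apply] using h

/-- Conjugation by `a` turns `a * b` into `b * a`, which is its inverse. -/
theorem IsPairing.mul_zpow_apply {a b : Perm α} (ha : IsPairing a) (hb : IsPairing b) (i : ℤ)
    (x : α) : a (((a * b) ^ i) x) = ((a * b) ^ (-i)) (a x) := by
  have h : a * (a * b) ^ i * a⁻¹ = (a * b) ^ (-i) := by
    rw [← conj_zpow, zpow_neg, ← inv_zpow, mul_inv_rev, ha.inv_eq, hb.inv_eq, ← mul_assoc a a b,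
      ha.mul_self, one_mul]
  rw [← h]
  simp

theorem IsPairing.sameCycle_apply {a b : Perm α} (ha : IsPairing a) (hb : IsPairing b) {x y : α}
    (h : (a * b).SameCycle x y) : (a * b).SameCycle (a x) (a y) := by
  obtain ⟨i, rfl⟩ := h
  exact ⟨-i, (ha.mul_zpow_apply hb i x).symm⟩

/-- If `a x = (ab)^i x`, the point halfway along, `(ab)^m x` with `i = 2m` or `i = 2m + 1`, would be
fixed by `a` or by `b` respectively. -/
theorem IsPairing.not_sameCycle {a b : Perm α} (ha : IsPairing a) (hb : IsPairing b) (x : α) :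
    ¬ (a * b).SameCycle x (a x) := by
  rintro ⟨i, hi⟩
  obtain ⟨m, rfl | rfl⟩ := Int.even_or_odd' i
  · apply ha.apply_ne (((a * b) ^ m) x)
    rw [ha.mul_zpow_apply hb, ← hi, ← Perm.mul_apply, ← zpow_add]
    congr 2
    ring
  · apply hb.apply_ne (((a * b) ^ m) x)
    apply a.injective
    rw [ha.mul_zpow_apply hb, ← hi, ← Perm.mul_apply, ← Perm.mul_apply, ← Perm.mul_apply,
      ← zpow_one_add, ← zpow_add]
    congr 2
    ring

/-- A set of points that is a union of cycles of `a * b`, and whose complement is its image under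
`a`. -/
theorem IsPairing.exists_half [Finite α] {a b : Perm α} (ha : IsPairing a) (hb : IsPairing b) :
    ∃ p : α → Prop, (∀ x, p ((a * b) x) ↔ p x) ∧ ∀ x, p (a x) ↔ ¬ p x := by
  -- Number the cycles of `a * b`; `a` matches distinct cycles in pairs, and the half `p` takes the
  -- cycle with the smaller number from each pair.
  obtain ⟨f, hf⟩ := Countable.exists_injective_nat (Quotient (Perm.SameCycle.setoid (a * b)))
  let q : α → ℕ := fun x => f (Quotient.mk _ x)
  have hq : ∀ x y, q x = q y ↔ (a * b).SameCycle x y := fun x y => by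
    rw [hf.eq_iff, Quotient.eq]
    rfl
  have h1 : ∀ x, q ((a * b) x) = q x := fun x => by
    rw [hq, Perm.sameCycle_apply_left]
  have h2 : ∀ x, q (a ((a * b) x)) = q (a x) := fun x => by
    rw [hq]
    exact ha.sameCycle_apply hb (Perm.sameCycle_apply_left.2 (Perm.SameCycle.refl _ _))
  have h3 : ∀ x, q x ≠ q (a x) := fun x h => ha.not_sameCycle hb x ((hq _ _).1 h)
  refine ⟨fun x => q x < q (a x), fun x => ?_, fun x => ?_⟩
  · simp only [h1, h2]
  · have := h3 x
    simp only [ha.apply_apply]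
    omega

theorem cycleType_permCongr [Fintype α] [DecidableEq α] [Fintype β] [DecidableEq β] (e : α ≃ β)
    (g : Perm α) : (e.permCongr g).cycleType = g.cycleType := by
  have h : e.permCongr g =
      g.extendDomain (e.trans (Equiv.subtypeUnivEquiv (p := fun _ => True) fun _ => trivial).symm) := by
    ext x
    rw [Perm.extendDomain_apply_subtype _ _ trivial]
    rfl
  rw [h, Perm.cycleType_extendDomain]

/-- If `u` is `a * b` on the half `p` and the identity elsewhere, then `a * b = u * (a * u⁻¹ *
a⁻¹)`; the second factor lives on the other half and has the cycle type of `u`. -/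
theorem IsPairing.cycleType_mul [Fintype α] [DecidableEq α] {a b : Perm α} (ha : IsPairing a)
    (hb : IsPairing b) (p : α → Prop) [DecidablePred p] (hp : ∀ x, p ((a * b) x) ↔ p x)
    (hap : ∀ x, p (a x) ↔ ¬ p x) :
    (a * b).cycleType = 2 • ((a * b).subtypePerm hp).cycleType := by
  set u := Perm.ofSubtype ((a * b).subtypePerm hp) with hu
  have hu1 : ∀ x, p x → u x = (a * b) x := fun x hx => by
    rw [hu, Perm.ofSubtype_subtypePerm_of_mem _ hx]
  have hu2 : ∀ x, ¬ p x → u x = x := fun x hx => by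
    rw [hu, Perm.ofSubtype_subtypePerm_of_not_mem _ hx]
  have hdis : Perm.Disjoint u (a * u⁻¹ * a⁻¹) := by
    intro x
    by_cases hx : p x
    · right
      simp only [Perm.mul_apply, ha.inv_eq]
      have : u⁻¹ (a x) = a x := by
        rw [Perm.inv_eq_iff_eq, hu2]
        rw [hap]
        simpa using hx
      rw [this, ha.apply_apply]
    · exact Or.inl (hu2 x hx)
  have hmul : u * (a * u⁻¹ * a⁻¹) = a * b := by
    ext x
    simp only [Perm.mul_apply, ha.inv_eq]
    by_cases hx : p x
    · have : u⁻¹ (a x) = a x := by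
        rw [Perm.inv_eq_iff_eq, hu2]
        rw [hap]
        simpa using hx
      rw [this, ha.apply_apply, hu1 x hx]
      rfl
    · have h1 : p (a x) := (hap x).2 hx
      have h2 : p (b x) := by
        rwa [← hp, Perm.mul_apply, hb.apply_apply]
      have : u⁻¹ (a x) = b x := by
        rw [Perm.inv_eq_iff_eq, hu1 _ h2, Perm.mul_apply, hb.apply_apply]
      rw [this, hu2]
      rw [hap]
      simpa using h2
  rw [← Perm.cycleType_ofSubtype, ← hu]
  conv_lhs => rw [← hmul]
  rw [hdis.cycleType_mul, Perm.cycleType_conj, Perm.cycleType_inv, two_nsmul]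

theorem two_nsmul_multiset_injective {s t : Multiset ℕ} (h : 2 • s = 2 • t) : s = t := by
  ext k
  have := congrArg (Multiset.count k) h
  simp only [Multiset.count_nsmul] at this
  omega

theorem exists_equiv_conj_of_cycleType_eq [Fintype α] [DecidableEq α] [Fintype β] [DecidableEq β]
    (hc : Fintype.card α = Fintype.card β) {g : Perm α} {g' : Perm β}
    (h : g.cycleType = g'.cycleType) : ∃ e : α ≃ β, ∀ x, e (g x) = g' (e x) := by
  let f := Fintype.equivOfCardEq hc
  rw [← cycleType_permCongr f, ← Perm.isConj_iff_cycleType_eq, isConj_iff] at h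
  obtain ⟨c, hc⟩ := h
  refine ⟨f.trans c, fun x => ?_⟩
  rw [← hc]
  simp

theorem card_eq_two_mul_of_half [Fintype α] (a : Perm α) (p : α → Prop) [DecidablePred p]
    (hap : ∀ x, p (a x) ↔ ¬ p x) : Fintype.card α = 2 * Fintype.card {x // p x} := by
  have h1 := Fintype.card_subtype_compl p
  have h2 : Fintype.card {x // p x} = Fintype.card {x // ¬ p x} :=
    Fintype.card_congr (a.subtypeEquiv fun x => by rw [hap, not_not])
  have h3 := Fintype.card_subtype_le p
  omega

/-- Two pairs of pairings are isomorphic if the products have the same cycle type. -/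
theorem IsPairing.exists_equiv [Fintype α] [DecidableEq α] [Fintype β] [DecidableEq β]
    {a b : Perm α} {a' b' : Perm β} (ha : IsPairing a) (hb : IsPairing b) (ha' : IsPairing a')
    (hb' : IsPairing b') (hc : Fintype.card α = Fintype.card β)
    (h : (a * b).cycleType = (a' * b').cycleType) :
    ∃ e : α ≃ β, e.permCongr a = a' ∧ e.permCongr b = b' := by
  classical
  obtain ⟨p, hp, hap⟩ := ha.exists_half hb
  obtain ⟨p', hp', hap'⟩ := ha'.exists_half hb'
  rw [ha.cycleType_mul hb p hp hap, ha'.cycleType_mul hb' p' hp' hap'] at h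
  have hc1 := card_eq_two_mul_of_half a p hap
  have hc2 := card_eq_two_mul_of_half a' p' hap'
  obtain ⟨f, hf⟩ := exists_equiv_conj_of_cycleType_eq (by omega) (two_nsmul_multiset_injective h)
  have hf' : ∀ x (hx : p x), (f ⟨(a * b) x, (hp x).2 hx⟩ : β) = (a' * b') (f ⟨x, hx⟩) :=
    fun x hx => congrArg Subtype.val (hf ⟨x, hx⟩)
  have hfp : ∀ x, p' (f x) := fun x => (f x).2
  -- On `p` a conjugation of the products is available from `f`; on the other half the value is
  -- forced by `F (a x) = a' (F x)`. Compatibility with `b` follows, since `b = a * (a * b)`.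
  let F : α → β := fun x => if hx : p x then f ⟨x, hx⟩ else a' (f ⟨a x, (hap x).2 hx⟩)
  have F1 : ∀ x (hx : p x), F x = f ⟨x, hx⟩ := fun x hx => dif_pos hx
  have F2 : ∀ x (hx : ¬ p x), F x = a' (f ⟨a x, (hap x).2 hx⟩) := fun x hx => dif_neg hx
  have hF : ∀ x, p' (F x) ↔ p x := by
    intro x
    by_cases hx : p x
    · rw [F1 x hx]
      simp [hx, hfp]
    · rw [F2 x hx, hap']
      simp [hx, hfp]
  have hFa : ∀ x, F (a x) = a' (F x) := by
    intro x
    by_cases hx : p x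
    · have : ¬ p (a x) := by rw [hap]; simpa using hx
      rw [F1 x hx, F2 _ this]
      simp only [ha.apply_apply]
    · rw [F2 x hx, F1 _ ((hap x).2 hx), ha'.apply_apply]
  have hFg : ∀ x, p x → F ((a * b) x) = (a' * b') (F x) := by
    intro x hx
    rw [F1 x hx, F1 _ ((hp x).2 hx), hf']
  have hFb : ∀ x, F (b x) = b' (F x) := by
    have h1 : ∀ x, p x → F (b x) = b' (F x) := by
      intro x hx
      have h := hFg x hx
      rw [Perm.mul_apply, hFa] at h
      exact a'.injective h
    intro x
    by_cases hx : p x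
    · exact h1 x hx
    · have hbx : p (b x) := by
        rw [← not_not (a := p (b x)), ← hap, ← Perm.mul_apply, hp]
        exact hx
      have h := h1 _ hbx
      rw [hb.apply_apply] at h
      rw [h, hb'.apply_apply]
  have hinj : Function.Injective F := by
    have h1 : ∀ x y, p x → F x = F y → x = y := by
      intro x y hx hxy
      have hy : p y := by rw [← hF, ← hxy, hF]; exact hx
      rw [F1 x hx, F1 y hy, Subtype.val_inj, f.injective.eq_iff] at hxy
      exact congrArg Subtype.val hxy
    intro x y hxy
    by_cases hx : p x
    · exact h1 x y hx hxy
    · apply a.injective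
      apply h1 _ _ ((hap x).2 hx)
      rw [hFa, hFa, hxy]
  have hbij := (Fintype.bijective_iff_injective_and_card F).2 ⟨hinj, hc⟩
  have hs : ∀ x, (Equiv.ofBijective F hbij).symm (F x) = x :=
    (Equiv.ofBijective F hbij).symm_apply_apply
  refine ⟨Equiv.ofBijective F hbij, ?_, ?_⟩ <;> ext y <;> obtain ⟨x, rfl⟩ := hbij.2 y
  · simp [hs, hFa]
  · simp [hs, hFb]

/-- Take two copies of `Fin m`: `a` swaps them, `b` swaps them with a twist by a permutation `h` of
cycle type `s`. Then `a * b` is `h` on the left copy. -/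
theorem exists_isPairing_of_card_eq [Fintype α] [DecidableEq α] {m : ℕ}
    (hα : Fintype.card α = 2 * m) {s : Multiset ℕ} (hs : ∀ k ∈ s, 2 ≤ k) (hm : s.sum ≤ m) :
    ∃ a b : Perm α, IsPairing a ∧ IsPairing b ∧ (a * b).cycleType = 2 • s := by
  obtain ⟨h, rfl⟩ := (Perm.exists_with_cycleType_iff (Fin m)).2 ⟨by simpa using hm, hs⟩
  let a : Perm (Fin m ⊕ Fin m) := Equiv.sumComm _ _
  let b : Perm (Fin m ⊕ Fin m) := (Equiv.sumComm _ _).trans (Equiv.sumCongr h⁻¹ h)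
  have ha : IsPairing a := ⟨by rintro (x | x) <;> rfl, by rintro (x | x) <;> simp [a]⟩
  have hb : IsPairing b := ⟨by rintro (x | x) <;> simp [b], by rintro (x | x) <;> simp [b]⟩
  let p : Fin m ⊕ Fin m → Prop := fun x => x.isLeft
  have hp : ∀ x, p ((a * b) x) ↔ p x := by rintro (x | x) <;> simp [a, b, p]
  have key := ha.cycleType_mul hb p hp (by rintro (x | x) <;> simp [a, p])
  let f : Fin m ≃ {x // p x} :=
    ⟨fun x => ⟨Sum.inl x, rfl⟩, fun x => Sum.getLeft x.1 x.2, fun _ => rfl, fun x => by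
      obtain ⟨x | x, hx⟩ := x
      · rfl
      · simp [p] at hx⟩
  have hf : (a * b).subtypePerm hp = f.permCongr h := by
    ext x
    obtain ⟨x, rfl⟩ := f.surjective x
    rw [Equiv.permCongr_apply, Equiv.symm_apply_apply]
    rfl
  let e : Fin m ⊕ Fin m ≃ α := Fintype.equivOfCardEq (by simp [hα, two_mul])
  refine ⟨e.permCongr a, e.permCongr b, ha.permCongr e, hb.permCongr e, ?_⟩
  have he : e.permCongr a * e.permCongr b = e.permCongr (a * b) := by
    ext x
    simp
  rw [he, cycleType_permCongr, key, hf, cycleType_permCongr]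

end Pairings
-- Coset-type as a cycle type, and double cosets of the hyperoctahedral group.
section CosetType

/-- The pairing of `[2n]` whose orbits are the blocks. -/
def blockSwap (n : ℕ) : Perm (Fin (2 * n)) :=
  Function.Involutive.toPerm
    (fun i => ⟨if i.val % 2 = 0 then i.val + 1 else i.val - 1, by split <;> omega⟩)
    fun i => by
      apply Fin.ext
      dsimp only
      split <;> split <;> omega

theorem val_blockSwap {n : ℕ} (i : Fin (2 * n)) :
    (blockSwap n i).val = if i.val % 2 = 0 then i.val + 1 else i.val - 1 := rfl

theorem div_eq_iff_blockSwap {n : ℕ} (i j : Fin (2 * n)) :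
    i.val / 2 = j.val / 2 ↔ i = j ∨ blockSwap n i = j := by
  rw [Fin.ext_iff, Fin.ext_iff, val_blockSwap]
  split <;> omega

theorem isPairing_blockSwap (n : ℕ) : IsPairing (blockSwap n) where
  apply_apply x := by
    rw [Fin.ext_iff, val_blockSwap, val_blockSwap]
    split <;> split <;> omega
  apply_ne x := by
    rw [Ne, Fin.ext_iff, val_blockSwap]
    split <;> omega

theorem mem_hyperoctahedral_iff {n : ℕ} (w : Perm (Fin (2 * n))) :
    w ∈ hyperoctahedral n ↔ w * blockSwap n = blockSwap n * w := by
  constructor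
  · intro hw
    ext1 x
    have h := (MapsBlocks.div_eq_iff hw x (blockSwap n x)).2
      ((div_eq_iff_blockSwap _ _).2 (Or.inr rfl))
    rw [div_eq_iff_blockSwap] at h
    obtain h | h := h
    · exact absurd (w.injective h).symm ((isPairing_blockSwap n).apply_ne x)
    · exact h.symm
  · intro hw
    have hw' : ∀ x, blockSwap n (w x) = w (blockSwap n x) := fun x =>
      (DFunLike.congr_fun hw x).symm
    refine mapsBlocks_of_div_eq_iff fun i j => ?_
    rw [div_eq_iff_blockSwap, div_eq_iff_blockSwap, hw', w.injective.eq_iff, w.injective.eq_iff]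

/-- The pairing of the exterior labels of `w` formed by the interior edges. -/
def interior {n : ℕ} (w : Perm (Fin (2 * n))) : Perm (Fin (2 * n)) := w⁻¹ * blockSwap n * w

theorem isPairing_interior {n : ℕ} (w : Perm (Fin (2 * n))) : IsPairing (interior w) :=
  (isPairing_blockSwap n).conj w

theorem div_eq_iff_interior {n : ℕ} (w : Perm (Fin (2 * n))) (i j : Fin (2 * n)) :
    (w i).val / 2 = (w j).val / 2 ↔ i = j ∨ interior w i = j := by
  rw [div_eq_iff_blockSwap, w.injective.eq_iff, interior, Perm.mul_apply, Perm.mul_apply,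
    Perm.inv_eq_iff_eq]

theorem cosetGraph_adj_iff {n : ℕ} (w : Perm (Fin (2 * n))) (i j : Fin (2 * n)) :
    (cosetGraph w).Adj i j ↔ blockSwap n i = j ∨ interior w i = j := by
  change (_ ∧ (_ ∨ _)) ↔ _
  rw [div_eq_iff_blockSwap, div_eq_iff_interior]
  have h1 : blockSwap n i = j → i ≠ j := by
    rintro rfl h
    exact (isPairing_blockSwap n).apply_ne i h.symm
  have h2 : interior w i = j → i ≠ j := by
    rintro rfl h
    exact (isPairing_interior w).apply_ne i h.symm
  tauto

/-- A component is the union of the cycles of `i` and `blockSwap n i`: passing along any edge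
interchanges the two alternatives, and an interior edge followed by an exterior one is a step of the
product. -/
theorem cosetGraph_reachable_iff {n : ℕ} (w : Perm (Fin (2 * n))) (i j : Fin (2 * n)) :
    (cosetGraph w).Reachable i j ↔
      (blockSwap n * interior w).SameCycle i j ∨
        (blockSwap n * interior w).SameCycle (blockSwap n i) j := by
  have ha := isPairing_blockSwap n
  have hb := isPairing_interior w
  constructor
  · rintro ⟨p⟩
    induction p with
    | nil => exact Or.inl (Perm.SameCycle.refl _ _)
    | @cons i k j hadj p ih =>
      rw [cosetGraph_adj_iff] at hadj
      obtain rfl | rfl := hadj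
      · rw [ha.apply_apply] at ih
        exact ih.symm
      · rw [← Perm.mul_apply, Perm.sameCycle_apply_left] at ih
        refine ih.symm.imp id fun h => ?_
        rw [← Perm.sameCycle_apply_left] at h
        rwa [Perm.mul_apply, hb.apply_apply] at h
  · have hR : ∀ x, (cosetGraph w).Reachable x ((blockSwap n * interior w) x) := fun x =>
      ((cosetGraph_adj_iff w _ _).2 (Or.inr rfl)).reachable.trans
        ((cosetGraph_adj_iff w _ _).2 (Or.inl rfl)).reachable
    have h : ∀ i j, (blockSwap n * interior w).SameCycle i j → (cosetGraph w).Reachable i j := by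
      intro i j h
      obtain ⟨k, -, rfl⟩ := h.exists_pow_eq'
      clear h
      induction k with
      | zero => exact SimpleGraph.Reachable.refl _
      | succ k ih =>
        rw [pow_succ', Perm.mul_apply]
        exact ih.trans (hR _)
    rintro (h1 | h1)
    · exact h _ _ h1
    · exact ((cosetGraph_adj_iff w _ _).2 (Or.inl rfl)).reachable.trans (h _ _ h1)

/-- Twice as many points lie on the component of `i` as on its cycle. -/
theorem ncard_supp_eq {n : ℕ} (w : Perm (Fin (2 * n))) (i : Fin (2 * n)) :
    ((cosetGraph w).connectedComponentMk i).supp.ncard =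
      2 * {j | (blockSwap n * interior w).SameCycle i j}.ncard := by
  have ha := isPairing_blockSwap n
  have hb := isPairing_interior w
  set g := blockSwap n * interior w
  have h : ((cosetGraph w).connectedComponentMk i).supp =
      {j | g.SameCycle i j} ∪ blockSwap n '' {j | g.SameCycle i j} := by
    ext j
    rw [SimpleGraph.ConnectedComponent.mem_supp_iff, SimpleGraph.ConnectedComponent.eq,
      SimpleGraph.reachable_comm, cosetGraph_reachable_iff]
    refine or_congr Iff.rfl ?_
    constructor
    · intro h
      exact ⟨blockSwap n j, by simpa [ha.apply_apply] using ha.sameCycle_apply hb h,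
        ha.apply_apply j⟩
    · rintro ⟨k, hk, rfl⟩
      exact ha.sameCycle_apply hb hk
  rw [h, Set.ncard_union_eq, Set.ncard_image_of_injective _ (blockSwap n).injective, ← two_mul]
  rw [Set.disjoint_left]
  rintro _ hx ⟨y, hy, rfl⟩
  exact ha.not_sameCycle hb y (hy.symm.trans hx)

/-- Counts the points lying on `k`-cycles. The bound `2 ≤ k` is needed because `cycleType` does not
record fixed points. -/
theorem card_ncard_sameCycle_eq {α : Type*} [Fintype α] [DecidableEq α] (g : Perm α) {k : ℕ}
    (hk : 2 ≤ k) :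
    {x | {y | g.SameCycle x y}.ncard = k}.ncard = k * g.cycleType.count k := by
  classical
  have key : ∀ x, {y | g.SameCycle x y}.ncard = k ↔
      ∃ c ∈ g.cycleFactorsFinset, c.support.card = k ∧ x ∈ c.support := by
    intro x
    by_cases hx : g x = x
    · have h1 : {y | g.SameCycle x y} = {x} := by
        ext y
        constructor
        · rintro ⟨i, rfl⟩
          exact Perm.zpow_apply_eq_self_of_apply_eq_self hx i
        · rintro rfl
          exact Perm.SameCycle.refl _ _
      rw [h1, Set.ncard_singleton]
      refine iff_of_false (by omega) ?_
      rintro ⟨c, hc, -, hxc⟩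
      have := Perm.mem_cycleFactorsFinset_support_le hc hxc
      rw [Perm.mem_support] at this
      exact this hx
    · have h1 : {y | g.SameCycle x y} = (g.cycleOf x).support := by
        ext y
        simp [Perm.mem_support_cycleOf_iff' hx]
      rw [h1, Set.ncard_coe_finset]
      constructor
      · intro h
        refine ⟨g.cycleOf x, Perm.cycleOf_mem_cycleFactorsFinset_iff.2 (Perm.mem_support.2 hx), h, ?_⟩
        rw [Perm.mem_support_cycleOf_iff' hx]
      · rintro ⟨c, hc, hck, hxc⟩
        rw [← Perm.cycle_is_cycleOf hxc hc, hck]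
  have h2 : {x | {y | g.SameCycle x y}.ncard = k} =
      ((g.cycleFactorsFinset.filter fun c => c.support.card = k).biUnion Perm.support : Finset α) := by
    ext x
    rw [Set.mem_ofPred_eq, key]
    simp [and_assoc]
  rw [h2, Set.ncard_coe_finset, Finset.card_biUnion, Perm.cycleType_def, Multiset.count_map]
  · rw [Finset.sum_congr rfl (g := fun _ => k), Finset.sum_const, smul_eq_mul, mul_comm]
    · simp only [Function.comp_apply, eq_comm (a := k)]
      rfl
    · intro c hc
      exact (Finset.mem_filter.1 hc).2
  · intro c hc d hd hcd
    exact (g.cycleFactorsFinset_pairwise_disjoint (Finset.mem_filter.1 hc).1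
      (Finset.mem_filter.1 hd).1 hcd).disjoint_support

theorem two_dvd_ncard_supp {n : ℕ} (w : Perm (Fin (2 * n)))
    (c : (cosetGraph w).ConnectedComponent) : 2 ∣ c.supp.ncard := by
  induction c using SimpleGraph.ConnectedComponent.ind with
  | h v => exact ⟨_, ncard_supp_eq w v⟩

theorem sum_cosetType {n : ℕ} (w : Perm (Fin (2 * n))) : (cosetType w).sum = n := by
  classical
  have h1 : 2 * (cosetType w).sum = ∑ c : (cosetGraph w).ConnectedComponent, c.supp.ncard := by
    change 2 * ∑ c : (cosetGraph w).ConnectedComponent, c.supp.ncard / 2 = _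
    rw [Finset.mul_sum]
    exact Finset.sum_congr rfl fun c _ => Nat.mul_div_cancel' (two_dvd_ncard_supp w c)
  have h2 := Finset.card_eq_sum_card_fiberwise (s := (Finset.univ : Finset (Fin (2 * n))))
    (t := Finset.univ) (f := (cosetGraph w).connectedComponentMk) fun _ _ => Finset.mem_univ _
  have h3 : ∀ c : (cosetGraph w).ConnectedComponent, c.supp.ncard =
      (Finset.univ.filter fun x => (cosetGraph w).connectedComponentMk x = c).card := by
    intro c
    rw [← Set.ncard_coe_finset]
    congr 1
    ext x
    simp
  rw [Finset.card_univ, Fintype.card_fin] at h2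
  simp only [h3, ← h2] at h1
  omega

theorem zero_notMem_cosetType {n : ℕ} (w : Perm (Fin (2 * n))) : 0 ∉ cosetType w := by
  intro h
  obtain ⟨c, -, hc⟩ := Multiset.mem_map.1 h
  have h1 := two_dvd_ncard_supp w c
  have h2 : 0 < c.supp.ncard := (Set.ncard_pos (Set.toFinite _)).2 c.nonempty_supp
  omega

/-- Double count of the points whose cycle has length `k`, i.e. whose component has `2k` vertices:
each cycle contributes `k` of them and each component `2k`. -/
theorem count_cycleType_eq {n : ℕ} (w : Perm (Fin (2 * n))) {k : ℕ} (hk : 2 ≤ k) :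
    (blockSwap n * interior w).cycleType.count k = 2 * (cosetType w).count k := by
  classical
  have h1 := card_ncard_sameCycle_eq (blockSwap n * interior w) hk
  have h2 : {x | {y | (blockSwap n * interior w).SameCycle x y}.ncard = k} =
      ((Finset.univ.filter fun x => k = ((cosetGraph w).connectedComponentMk x).supp.ncard / 2 :
        Finset _) : Set (Fin (2 * n))) := by
    ext x
    rw [Finset.coe_filter, Set.mem_ofPred_eq, Set.mem_ofPred_eq, ncard_supp_eq]
    simp [eq_comm]
  rw [h2, Set.ncard_coe_finset, Finset.card_eq_sum_card_fiberwise
    (t := Finset.univ.filter fun c : (cosetGraph w).ConnectedComponent => k = c.supp.ncard / 2)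
    (f := (cosetGraph w).connectedComponentMk) (fun x hx => by simpa using hx),
    Finset.sum_congr rfl (g := fun _ => 2 * k), Finset.sum_const, smul_eq_mul] at h1
  · unfold cosetType
    rw [Multiset.count_map]
    have h3 : (Finset.univ.filter fun c : (cosetGraph w).ConnectedComponent =>
        k = c.supp.ncard / 2).card = (Multiset.filter (fun c : (cosetGraph w).ConnectedComponent =>
        k = c.supp.ncard / 2) Finset.univ.val).card := rfl
    rw [← h3]
    refine (Nat.eq_of_mul_eq_mul_left (by omega : 0 < k) ?_).symm
    rw [← h1]
    ring
  · intro c hc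
    have hc := (Finset.mem_filter.1 hc).2
    have h4 := Nat.mul_div_cancel' (two_dvd_ncard_supp w c)
    rw [hc, h4, ← Set.ncard_coe_finset]
    congr 1
    ext x
    simp only [Finset.coe_filter, Finset.mem_filter, Finset.mem_univ, true_and, Set.mem_ofPred_eq,
      SimpleGraph.ConnectedComponent.mem_supp_iff]
    constructor
    · exact fun h => h.2
    · rintro rfl
      exact ⟨rfl, rfl⟩

theorem count_eq_of_le_one (lam : ProperPartition) {k : ℕ} (hk : k < 2) :
    lam.parts.count k = 0 := by
  rw [Multiset.count_eq_zero]
  intro h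
  have h0 := lam.parts_pos k h
  obtain rfl : k = 1 := by omega
  exact lam.one_notMem h

theorem two_le_of_mem_parts (lam : ProperPartition) {k : ℕ} (hk : k ∈ lam.parts) : 2 ≤ k := by
  by_contra h
  exact Multiset.count_ne_zero.2 hk (count_eq_of_le_one lam (by omega))

theorem count_cycleType_of_lt {α : Type*} [Fintype α] [DecidableEq α] (g : Perm α) {k : ℕ}
    (hk : k < 2) : g.cycleType.count k = 0 := by
  rw [Multiset.count_eq_zero]
  intro h
  have := Perm.two_le_of_mem_cycleType h
  omega

/-- The coset-type of `w` is `λ ∪ (1^{n-|λ|})`. -/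
def HasType {n : ℕ} (w : Perm (Fin (2 * n))) (lam : ProperPartition) : Prop :=
  lam.size ≤ n ∧ cosetType w = lam.parts + Multiset.replicate (n - lam.size) 1

/-- Parts at least `2` are compared through `count_cycleType_eq`; the number of parts `1`, invisible
to `cycleType`, is recovered from `sum_cosetType`. -/
theorem hasType_iff {n : ℕ} (w : Perm (Fin (2 * n))) (lam : ProperPartition) :
    HasType w lam ↔ (blockSwap n * interior w).cycleType = 2 • lam.parts := by
  constructor
  · rintro ⟨-, h⟩
    ext k
    rw [Multiset.count_nsmul]
    rcases lt_or_ge k 2 with hk | hk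
    · rw [count_eq_of_le_one _ hk, count_cycleType_of_lt _ hk]
    · rw [count_cycleType_eq w hk, h, Multiset.count_add, Multiset.count_replicate,
        if_neg (by omega), add_zero]
  · intro h
    have h1 : cosetType w = lam.parts + Multiset.replicate ((cosetType w).count 1) 1 := by
      ext k
      rw [Multiset.count_add, Multiset.count_replicate]
      rcases lt_or_ge k 2 with hk | hk
      · rw [count_eq_of_le_one _ hk]
        obtain rfl | rfl : k = 0 ∨ k = 1 := by omega
        · simpa using zero_notMem_cosetType w
        · simp
      · have h2 := count_cycleType_eq w hk
        rw [h, Multiset.count_nsmul] at h2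
        rw [if_neg (by omega)]
        omega
    have h2 : n = lam.size + (cosetType w).count 1 := by
      have h3 := congrArg Multiset.sum h1
      rw [sum_cosetType, Multiset.sum_add, Multiset.sum_replicate, smul_eq_mul, mul_one] at h3
      exact h3
    refine ⟨by omega, ?_⟩
    have h4 : n - lam.size = (cosetType w).count 1 := by omega
    rw [h4]
    exact h1

theorem HasType.unique {n : ℕ} {w : Perm (Fin (2 * n))} {lam del : ProperPartition}
    (h : HasType w lam) (h' : HasType w del) : lam = del := by
  rw [hasType_iff] at h h'
  exact ProperPartition.ext (two_nsmul_multiset_injective (h.symm.trans h'))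

theorem exists_hasType_of_perm {n : ℕ} (w : Perm (Fin (2 * n))) :
    ∃ lam : ProperPartition, HasType w lam := by
  refine ⟨⟨(cosetType w).filter (2 ≤ ·), fun p hp => ?_, fun h => ?_⟩, ?_⟩
  · have := (Multiset.mem_filter.1 hp).2
    omega
  · have := (Multiset.mem_filter.1 h).2
    omega
  · rw [hasType_iff]
    ext k
    rw [Multiset.count_nsmul]
    rcases lt_or_ge k 2 with hk | hk
    · rw [count_cycleType_of_lt _ hk, Multiset.count_filter_of_neg (by omega)]
    · rw [count_cycleType_eq w hk, Multiset.count_filter_of_pos hk]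

theorem exists_interior_eq {n : ℕ} {b : Perm (Fin (2 * n))} (hb : IsPairing b) :
    ∃ w, interior w = b := by
  have ha := isPairing_blockSwap n
  -- Any two pairings are conjugate: compare the degenerate pairs `(a, a)` and `(b, b)`, whose
  -- products are both `1`.
  obtain ⟨e, he, -⟩ := ha.exists_equiv ha hb hb rfl (by rw [ha.mul_self, hb.mul_self])
  refine ⟨e⁻¹, ?_⟩
  rw [← he]
  rfl

theorem exists_perm_hasType {n : ℕ} (lam : ProperPartition) (h : lam.size ≤ n) :
    ∃ w : Perm (Fin (2 * n)), HasType w lam := by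
  obtain ⟨a, b, ha, hb, hab⟩ := exists_isPairing_of_card_eq (Fintype.card_fin (2 * n))
    (fun k hk => two_le_of_mem_parts lam hk) h
  have hs := isPairing_blockSwap n
  obtain ⟨e, he, -⟩ := ha.exists_equiv ha hs hs rfl (by rw [ha.mul_self, hs.mul_self])
  obtain ⟨w, hw⟩ := exists_interior_eq (hb.permCongr e)
  refine ⟨w, ?_⟩
  have h2 : e.permCongr a * e.permCongr b = e.permCongr (a * b) := by
    ext x
    simp
  rw [hasType_iff, hw, ← he, h2, cycleType_permCongr, hab]

/-- Permutations of the same coset-type lie in the same double coset. -/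
theorem HasType.exists_mul_mul_eq {n : ℕ} {w w' : Perm (Fin (2 * n))} {lam : ProperPartition}
    (h : HasType w lam) (h' : HasType w' lam) :
    ∃ b ∈ hyperoctahedral n, ∃ b' ∈ hyperoctahedral n, b * w * b' = w' := by
  rw [hasType_iff] at h h'
  have hs := isPairing_blockSwap n
  obtain ⟨e, he1, he2⟩ := hs.exists_equiv (isPairing_interior w) hs (isPairing_interior w') rfl
    (h.trans h'.symm)
  have he1 : e * blockSwap n * e⁻¹ = blockSwap n := he1
  have he2 : e * (w⁻¹ * blockSwap n * w) * e⁻¹ = w'⁻¹ * blockSwap n * w' := he2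
  -- `e` commutes with the block pairing by `he1`, and `w' * e * w⁻¹` does because `e` carries
  -- `interior w` to `interior w'`.
  refine ⟨w' * e * w⁻¹, ?_, e⁻¹, inv_mem ?_, by group⟩
  · rw [mem_hyperoctahedral_iff]
    have := congrArg (fun x => w' * x * e * w⁻¹) he2
    simp only [mul_assoc, mul_inv_cancel_left, inv_mul_cancel, mul_one,
      mul_inv_cancel] at this
    simpa only [mul_assoc] using this
  · rw [mem_hyperoctahedral_iff]
    conv_rhs => rw [← he1]
    group

theorem card_hyperoctahedral (n : ℕ) : Nat.card (hyperoctahedral n) = 2 ^ n * n.factorial := by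
  have hs := isPairing_blockSwap n
  have h1 : hyperoctahedral n = Subgroup.centralizer {blockSwap n} := by
    ext w
    rw [mem_hyperoctahedral_iff, Subgroup.mem_centralizer_singleton_iff]
  have h2 : blockSwap n ^ 2 = 1 := by rw [sq, hs.mul_self]
  have h3 := Perm.cycleType_of_pow_prime_eq_one h2
  have h4 : (blockSwap n).cycleType.sum = 2 * n := by
    have : (blockSwap n).support = Finset.univ := by
      ext x
      simp [hs.apply_ne]
    rw [Perm.sum_cycleType, this, Finset.card_univ, Fintype.card_fin]
  rw [h3, Multiset.sum_replicate, smul_eq_mul] at h4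
  have h5 : (blockSwap n).cycleType = Multiset.replicate n 2 := by
    rw [h3]
    congr 1
    omega
  rw [h1, Perm.nat_card_centralizer, h5, Multiset.sum_replicate, Multiset.prod_replicate,
    Fintype.card_fin, smul_eq_mul, mul_comm n 2, Nat.sub_self, Nat.factorial_zero, one_mul]
  rcases Nat.eq_zero_or_pos n with rfl | hn
  · simp
  · rw [Multiset.toFinset_replicate, if_neg hn.ne', Finset.prod_singleton,
      Multiset.count_replicate_self]

end CosetType
-- Counting matchings against a pair of matchings, and invariance of the count.
section Counting

variable {α β : Type*}

/-- The number of pairings `m` such that `m * a` and `m * b` have prescribed cycle types and there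
is no point at which `m`, `a` and `b` all agree. -/
noncomputable def fullCount [Fintype α] [DecidableEq α] (a b : Perm α) (s t : Multiset ℕ) : ℕ :=
  {m : Perm α | (IsPairing m ∧ (m * a).cycleType = s ∧ (m * b).cycleType = t) ∧
    ∀ x, m x ≠ a x ∨ m x ≠ b x}.ncard

theorem isPairing_permCongr_iff (e : α ≃ β) (m : Perm α) :
    IsPairing (e.permCongr m) ↔ IsPairing m := by
  refine ⟨fun h => ?_, fun h => h.permCongr e⟩
  have := h.permCongr e.symm
  rwa [← Equiv.permCongr_symm, Equiv.symm_apply_apply] at this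

theorem fullCount_permCongr [Fintype α] [DecidableEq α] [Fintype β] [DecidableEq β] (e : α ≃ β)
    (a b : Perm α) (s t : Multiset ℕ) :
    fullCount (e.permCongr a) (e.permCongr b) s t = fullCount a b s t := by
  have hmul : ∀ m a : Perm α, e.permCongr m * e.permCongr a = e.permCongr (m * a) := by
    intro m a
    ext x
    simp
  unfold fullCount
  symm
  rw [← Set.ncard_image_of_injective _ e.permCongr.injective]
  congr 1
  ext m
  obtain ⟨m, rfl⟩ := e.permCongr.surjective m
  rw [e.permCongr.injective.mem_set_image, Set.mem_ofPred_eq, Set.mem_ofPred_eq, hmul, hmul,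
    cycleType_permCongr, cycleType_permCongr, isPairing_permCongr_iff, e.forall_congr_left]
  simp only [Equiv.permCongr_apply, ne_eq, e.injective.eq_iff]

/-- The number of pairings of given types with respect to the two members of a pair of pairings of
type `ρ ∪ (1^j)`, that nowhere agree with both of them. -/
noncomputable def typeCount (rho : ProperPartition) (s t : Multiset ℕ) (j : ℕ) : ℕ :=
  have h := exists_isPairing_of_card_eq (Fintype.card_fin (2 * (rho.size + j)))
    (fun _ hk => two_le_of_mem_parts rho hk) (Nat.le_add_right rho.size j)
  fullCount h.choose h.choose_spec.choose s t

/-- The model chosen in `typeCount` is immaterial, as every pair of this size and type is isomorphic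
to it. This makes the coefficients `a_j` independent of `n`. -/
theorem fullCount_eq_typeCount [Fintype α] [DecidableEq α] {a b : Perm α} (ha : IsPairing a)
    (hb : IsPairing b) {rho : ProperPartition} {j : ℕ}
    (hc : Fintype.card α = 2 * (rho.size + j)) (h : (a * b).cycleType = 2 • rho.parts)
    (s t : Multiset ℕ) : fullCount a b s t = typeCount rho s t j := by
  have hex := exists_isPairing_of_card_eq (Fintype.card_fin (2 * (rho.size + j)))
    (fun _ hk => two_le_of_mem_parts rho hk) (Nat.le_add_right rho.size j)
  obtain ⟨h1, h2, h3⟩ := hex.choose_spec.choose_spec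
  obtain ⟨e, he1, he2⟩ := ha.exists_equiv hb h1 h2 (by rw [hc, Fintype.card_fin]) (h.trans h3.symm)
  rw [← fullCount_permCongr e, he1, he2]
  rfl

/-- A point fixed by both `m * a` and `m * b` would be one where `m`, `a`, `b` agree. So the two
supports, of sizes `s.sum` and `t.sum`, cover everything. -/
theorem typeCount_eq_zero (rho : ProperPartition) {s t : Multiset ℕ} {j : ℕ}
    (h : s.sum + t.sum < 2 * (rho.size + j)) : typeCount rho s t j = 0 := by
  unfold typeCount fullCount
  rw [Set.ncard_eq_zero (Set.toFinite _), Set.eq_empty_iff_forall_notMem]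
  rintro m ⟨⟨hm, rfl, rfl⟩, hx⟩
  rw [Perm.sum_cycleType, Perm.sum_cycleType] at h
  refine absurd ((Finset.card_union_le _ _).trans_lt h) (not_lt.2 ?_)
  refine le_of_eq_of_le (Fintype.card_fin _).symm
    (Finset.card_le_card (s := Finset.univ) fun x _ => ?_)
  rw [Finset.mem_union, Perm.mem_support, Perm.mem_support, Perm.mul_apply, Perm.mul_apply]
  by_contra hcon
  push Not at hcon
  have h1 := congrArg m hcon.1
  have h2 := congrArg m hcon.2
  rw [hm.apply_apply] at h1 h2
  exact (hx x).elim (fun h => h h1.symm) fun h => h h2.symm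

/-- Off `p` the pairing `m` equals `a = b`, so it is determined by its restriction to `p`, and both
products have only fixed points there, which leave the cycle types unchanged. -/
theorem ncard_eq_fullCount [Fintype α] [DecidableEq α] {a b : Perm α} (ha : IsPairing a)
    (hb : IsPairing b) (p : α → Prop) [DecidablePred p] (hpa : ∀ x, p (a x) ↔ p x)
    (hpb : ∀ x, p (b x) ↔ p x) (hab : ∀ x, ¬ p x → a x = b x) (s t : Multiset ℕ) :
    {m : Perm α | (IsPairing m ∧ (m * a).cycleType = s ∧ (m * b).cycleType = t) ∧
      ∀ x, p x ↔ m x ≠ a x ∨ m x ≠ b x}.ncard =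
      fullCount (a.subtypePerm hpa) (b.subtypePerm hpb) s t := by
  -- `E m` is `m` on `p` and `a` off `p`; written this way, `E m * a` is visibly an extension by the
  -- identity.
  let E : Perm {x // p x} → Perm α := fun m => Perm.ofSubtype (m * a.subtypePerm hpa) * a
  have E1 : ∀ m x (hx : p x), E m x = m ⟨x, hx⟩ := by
    intro m x hx
    rw [Perm.mul_apply, Perm.ofSubtype_apply_of_mem _ ((hpa x).2 hx)]
    simp [ha.apply_apply]
  have E2 : ∀ m x, ¬ p x → E m x = a x := by
    intro m x hx
    rw [Perm.mul_apply, Perm.ofSubtype_apply_of_not_mem]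
    rwa [hpa]
  have hE : ∀ m x, p (E m x) ↔ p x := by
    intro m x
    by_cases hx : p x
    · rw [E1 m x hx]
      simp [hx, (m ⟨x, hx⟩).2]
    · rw [E2 m x hx, hpa]
  have Ea : ∀ m, E m * a = Perm.ofSubtype (m * a.subtypePerm hpa) := by
    intro m
    rw [mul_assoc, ha.mul_self, mul_one]
  have Eb : ∀ m, E m * b = Perm.ofSubtype (m * b.subtypePerm hpb) := by
    intro m
    ext x
    by_cases hx : p x
    · rw [Perm.mul_apply, E1 m _ ((hpb x).2 hx), Perm.ofSubtype_apply_of_mem _ hx]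
      rfl
    · rw [Perm.mul_apply, E2 m _ (by rwa [hpb]), Perm.ofSubtype_apply_of_not_mem _ hx, hab,
        hb.apply_apply]
      rwa [hpb]
  have hpair : ∀ m, IsPairing (E m) ↔ IsPairing m := by
    intro m
    constructor
    · refine fun h => ⟨fun x => ?_, fun x hx => ?_⟩
      · have := h.apply_apply x
        rw [E1 m x x.2, E1 m _ (m x).2] at this
        exact Subtype.ext this
      · apply h.apply_ne x
        rw [E1 m x x.2]
        exact congrArg Subtype.val hx
    · refine fun h => ⟨fun x => ?_, fun x hx => ?_⟩
      · by_cases hx : p x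
        · rw [E1 m x hx, E1 m _ (m ⟨x, hx⟩).2, h.apply_apply]
        · rw [E2 m x hx, E2 m _ (by rwa [hpa]), ha.apply_apply]
      · by_cases hpx : p x
        · rw [E1 m x hpx] at hx
          exact h.apply_ne ⟨x, hpx⟩ (Subtype.ext hx)
        · rw [E2 m x hpx] at hx
          exact ha.apply_ne x hx
  have hsupp : ∀ m, (∀ x, p x ↔ E m x ≠ a x ∨ E m x ≠ b x) ↔
      ∀ x, m x ≠ a.subtypePerm hpa x ∨ m x ≠ b.subtypePerm hpb x := by
    intro m
    constructor
    · intro h x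
      have h1 := (h x).1 x.2
      rw [E1 m x x.2] at h1
      exact h1.imp (fun h2 h3 => h2 (congrArg Subtype.val h3))
        fun h2 h3 => h2 (congrArg Subtype.val h3)
    · intro h x
      by_cases hx : p x
      · rw [E1 m x hx]
        exact iff_of_true hx ((h ⟨x, hx⟩).imp (fun h2 h3 => h2 (Subtype.ext h3))
          fun h2 h3 => h2 (Subtype.ext h3))
      · rw [E2 m x hx, ← hab x hx]
        simp [hx]
  have hmem : ∀ m, ((IsPairing (E m) ∧ (E m * a).cycleType = s ∧ (E m * b).cycleType = t) ∧
      ∀ x, p x ↔ E m x ≠ a x ∨ E m x ≠ b x) ↔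
      (IsPairing m ∧ (m * a.subtypePerm hpa).cycleType = s ∧
        (m * b.subtypePerm hpb).cycleType = t) ∧
        ∀ x, m x ≠ a.subtypePerm hpa x ∨ m x ≠ b.subtypePerm hpb x := by
    intro m
    rw [hpair, hsupp, Ea, Eb, Perm.cycleType_ofSubtype, Perm.cycleType_ofSubtype]
  unfold fullCount
  symm
  refine Set.ncard_congr (fun m _ => E m) (fun m hm => (hmem m).2 hm) ?_ ?_
  · intro m m' _ _ h
    ext x
    rw [← E1 m x x.2, ← E1 m' x x.2, h]
  · intro m hm1
    have hpm : ∀ x, p (m x) ↔ p x := by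
      have h1 : ∀ x, ¬ p x → ¬ p (m x) := by
        intro x hx
        have h2 := hx
        rw [hm1.2] at h2
        push Not at h2
        rwa [h2.1, hpa]
      intro x
      refine ⟨fun h => by_contra fun hx => h1 x hx h, fun h => by_contra fun hx => ?_⟩
      have := h1 _ hx
      rw [hm1.1.1.apply_apply] at this
      exact this h
    have hEm : E (m.subtypePerm hpm) = m := by
      ext x
      by_cases hx : p x
      · rw [E1 _ x hx]
        rfl
      · rw [E2 _ x hx]
        rw [hm1.2] at hx
        push Not at hx
        rw [hx.1]
    refine ⟨m.subtypePerm hpm, ?_, hEm⟩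
    rw [← hEm] at hm1
    exact (hmem _).1 hm1

end Counting
-- Sorting matchings by the blocks on which they disagree.
section PairingCount

/-- The label of the block containing a point. -/
def blockIndex {n : ℕ} (i : Fin (2 * n)) : Fin n := ⟨i.val / 2, div_lt i⟩

theorem blockIndex_eq_iff {n : ℕ} (i j : Fin (2 * n)) :
    blockIndex i = blockIndex j ↔ i = j ∨ blockSwap n i = j := by
  rw [← div_eq_iff_blockSwap, blockIndex, blockIndex, Fin.mk.injEq]

theorem blockIndex_blockSwap {n : ℕ} (i : Fin (2 * n)) :
    blockIndex (blockSwap n i) = blockIndex i :=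
  ((blockIndex_eq_iff _ _).2 (Or.inr rfl)).symm

theorem card_filter_blockIndex {n : ℕ} (t : Finset (Fin n)) :
    (Finset.univ.filter fun x : Fin (2 * n) => blockIndex x ∈ t).card = 2 * t.card := by
  rw [Finset.card_eq_sum_card_fiberwise (t := t) (f := blockIndex)
    (fun x hx => by simpa using hx), Finset.sum_congr rfl (g := fun _ => 2), Finset.sum_const,
    smul_eq_mul, mul_comm]
  intro k hk
  have hk' := k.isLt
  rw [Finset.card_eq_two]
  refine ⟨⟨2 * k.val, by omega⟩, ⟨2 * k.val + 1, by omega⟩, by simp, ?_⟩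
  ext x
  have hx : blockIndex x = k ↔ x.val / 2 = k.val := Fin.ext_iff
  simp only [Finset.mem_filter, Finset.mem_univ, true_and, Finset.mem_insert,
    Finset.mem_singleton, Fin.ext_iff]
  constructor
  · rintro ⟨-, h⟩
    omega
  · intro h
    have h2 : x.val / 2 = k.val := by omega
    exact ⟨by rwa [hx.2 h2], h2⟩

open Classical in
/-- The blocks containing a point at which `m`, the block pairing and `b` do not all agree. -/
noncomputable def disagreement {n : ℕ} (b m : Perm (Fin (2 * n))) : Finset (Fin n) :=
  Finset.univ.filter fun k => ∃ x, blockIndex x = k ∧ (m x ≠ blockSwap n x ∨ m x ≠ b x)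

/-- Disagreement is a property of the whole block: if the three involutions agree at `x`, they also
agree at the common image, which is the other point of the block. -/
theorem blockIndex_mem_disagreement {n : ℕ} {b m : Perm (Fin (2 * n))} (hb : IsPairing b)
    (hm : IsPairing m) (x : Fin (2 * n)) :
    blockIndex x ∈ disagreement b m ↔ m x ≠ blockSwap n x ∨ m x ≠ b x := by
  have ha := isPairing_blockSwap n
  rw [disagreement, Finset.mem_filter]
  refine ⟨?_, fun h => ⟨Finset.mem_univ _, x, rfl, h⟩⟩
  rintro ⟨-, y, hyx, hy⟩
  rw [blockIndex_eq_iff] at hyx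
  obtain rfl | rfl := hyx
  · exact hy
  · by_contra hcon
    push Not at hcon
    obtain ⟨h1, h2⟩ := hcon
    rw [ha.apply_apply] at h1
    have h3 : m y = blockSwap n y := by rw [← h1, hm.apply_apply]; exact h1.symm ▸ rfl
    have h4 : b y = blockSwap n y := by
      rw [h1] at h2
      conv_lhs => rw [h2, hb.apply_apply]
    exact hy.elim (fun h => h h3) fun h => h (h3.trans h4.symm)

theorem disagreement_eq_iff {n : ℕ} {b m : Perm (Fin (2 * n))} (hb : IsPairing b)
    (hm : IsPairing m) (t : Finset (Fin n)) :
    disagreement b m = t ↔ ∀ x, blockIndex x ∈ t ↔ m x ≠ blockSwap n x ∨ m x ≠ b x := by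
  constructor
  · rintro rfl x
    exact blockIndex_mem_disagreement hb hm x
  · intro h
    ext k
    have hk := k.isLt
    obtain ⟨x, rfl⟩ : ∃ x : Fin (2 * n), blockIndex x = k :=
      ⟨⟨2 * k.val, by omega⟩, by simp [blockIndex]⟩
    rw [h, blockIndex_mem_disagreement hb hm]

theorem card_disagreement_blockSwap {n : ℕ} {b : Perm (Fin (2 * n))} (hb : IsPairing b) :
    2 * (disagreement b (blockSwap n)).card = (blockSwap n * b).cycleType.sum := by
  have ha := isPairing_blockSwap n
  rw [← card_filter_blockIndex, Perm.sum_cycleType]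
  congr 1
  ext x
  rw [Finset.mem_filter, blockIndex_mem_disagreement hb ha, Perm.mem_support, Perm.mul_apply]
  have hx : blockSwap n x = b x ↔ blockSwap n (b x) = x :=
    ⟨fun h => by rw [← h, ha.apply_apply], fun h => by rw [← ha.apply_apply (b x), h]⟩
  simp [hx]

theorem cycleType_subtypePerm_mul_subtypePerm {α : Type*} [Fintype α] [DecidableEq α]
    {p : α → Prop} [DecidablePred p] {a b : Perm α} (hpa : ∀ x, p (a x) ↔ p x)
    (hpb : ∀ x, p (b x) ↔ p x) (h : ∀ x, ¬ p x → a (b x) = x) :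
    (a.subtypePerm hpa * b.subtypePerm hpb).cycleType = (a * b).cycleType := by
  have hp : ∀ x, p ((a * b) x) ↔ p x := fun x => (hpa (b x)).trans (hpb x)
  have h1 : a.subtypePerm hpa * b.subtypePerm hpb = (a * b).subtypePerm hp := rfl
  have h2 : Perm.ofSubtype ((a * b).subtypePerm hp) = a * b :=
    Perm.ofSubtype_subtypePerm hp fun x hx => by_contra fun hpx => hx (h x hpx)
  rw [h1, ← Perm.cycleType_ofSubtype, h2]

/-- The pairings of given types with respect to the block pairing and to `b`. -/
def pairings {n : ℕ} (b : Perm (Fin (2 * n))) (s t : Multiset ℕ) : Set (Perm (Fin (2 * n))) :=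
  {m | IsPairing m ∧ (m * blockSwap n).cycleType = s ∧ (m * b).cycleType = t}

/-- Since `u` contains all blocks where `b` differs from the block pairing, everything restricts to
the points over `u`, where the pair still has type `ρ`, now with `u.card - rho.size` parts `1`. -/
theorem ncard_pairings_disagreement_eq {n : ℕ} {b : Perm (Fin (2 * n))} (hb : IsPairing b)
    {rho : ProperPartition} (h : (blockSwap n * b).cycleType = 2 • rho.parts) (s t : Multiset ℕ)
    {u : Finset (Fin n)} (hu : disagreement b (blockSwap n) ⊆ u) :
    {m ∈ pairings b s t | disagreement b m = u}.ncard =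
      typeCount rho s t (u.card - rho.size) := by
  have ha := isPairing_blockSwap n
  have hsum : (2 • rho.parts).sum = 2 * rho.size := by
    rw [Multiset.sum_nsmul, smul_eq_mul, ProperPartition.size]
  have hcard := card_disagreement_blockSwap hb
  rw [h, hsum] at hcard
  have hab : ∀ x : Fin (2 * n), ¬ blockIndex x ∈ u → blockSwap n x = b x := by
    intro x hx
    by_contra hne
    exact hx (hu ((blockIndex_mem_disagreement hb ha x).2 (Or.inr hne)))
  have hpa : ∀ x : Fin (2 * n), blockIndex (blockSwap n x) ∈ u ↔ blockIndex x ∈ u := by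
    intro x
    rw [blockIndex_blockSwap]
  have hpb : ∀ x : Fin (2 * n), blockIndex (b x) ∈ u ↔ blockIndex x ∈ u := by
    have h1 : ∀ x, ¬ blockIndex x ∈ u → ¬ blockIndex (b x) ∈ u := by
      intro x hx
      rwa [← hab x hx, hpa]
    intro x
    refine ⟨fun h => by_contra fun hx => h1 x hx h, fun h => by_contra fun hx => ?_⟩
    have := h1 _ hx
    rw [hb.apply_apply] at this
    exact this h
  have h1 : {m ∈ pairings b s t | disagreement b m = u} =
      {m | (IsPairing m ∧ (m * blockSwap n).cycleType = s ∧ (m * b).cycleType = t) ∧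
        ∀ x, blockIndex x ∈ u ↔ m x ≠ blockSwap n x ∨ m x ≠ b x} := by
    ext m
    exact and_congr_right fun hm => disagreement_eq_iff hb hm.1 u
  rw [h1, ncard_eq_fullCount ha hb (fun x => blockIndex x ∈ u) hpa hpb hab]
  refine fullCount_eq_typeCount ⟨fun x => Subtype.ext (ha.apply_apply _),
    fun x hx => ha.apply_ne x (congrArg Subtype.val hx)⟩
    ⟨fun x => Subtype.ext (hb.apply_apply _),
    fun x hx => hb.apply_ne x (congrArg Subtype.val hx)⟩ ?_ ?_ s t
  · rw [Fintype.card_subtype, card_filter_blockIndex]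
    have := Finset.card_le_card hu
    omega
  · rw [← h]
    refine cycleType_subtypePerm_mul_subtypePerm hpa hpb fun x hx => ?_
    rw [← hab x hx, ha.apply_apply]

theorem ncard_pairings {n : ℕ} {b : Perm (Fin (2 * n))} (hb : IsPairing b)
    {rho : ProperPartition} (h : (blockSwap n * b).cycleType = 2 • rho.parts)
    (s t : Multiset ℕ) :
    (pairings b s t).ncard = ∑ j ∈ Finset.range (n - rho.size + 1),
      (n - rho.size).choose j * typeCount rho s t j := by
  classical
  have ha := isPairing_blockSwap n
  set d := disagreement b (blockSwap n) with hd
  have hcard := card_disagreement_blockSwap hb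
  rw [h, Multiset.sum_nsmul, smul_eq_mul, ← ProperPartition.size, ← hd] at hcard
  have h1 : (pairings b s t).ncard =
      ∑ u : Finset (Fin n), {m ∈ pairings b s t | disagreement b m = u}.ncard := by
    rw [Set.ncard_eq_toFinset_card', Finset.card_eq_sum_card_fiberwise (t := Finset.univ)
      (f := disagreement b) (fun _ _ => Finset.mem_univ _)]
    refine Finset.sum_congr rfl fun u _ => ?_
    rw [Set.ncard_eq_toFinset_card']
    congr 1
    ext m
    simp
  -- Where the block pairing and `b` differ, no `m` can agree with both, so only sets `u ⊇ d`
  -- contribute.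
  have h2 : ∑ u : Finset (Fin n), {m ∈ pairings b s t | disagreement b m = u}.ncard =
      ∑ u : Finset (Fin n) with d ⊆ u, {m ∈ pairings b s t | disagreement b m = u}.ncard := by
    symm
    refine Finset.sum_subset (Finset.filter_subset _ _) fun u _ hu => ?_
    rw [Set.ncard_eq_zero (Set.toFinite _), Set.eq_empty_iff_forall_notMem]
    rintro m ⟨hm, rfl⟩
    apply hu
    rw [Finset.mem_filter]
    refine ⟨Finset.mem_univ _, fun k hk => ?_⟩
    rw [hd, disagreement, Finset.mem_filter] at hk
    obtain ⟨-, x, rfl, hx⟩ := hk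
    rw [blockIndex_mem_disagreement hb hm.1]
    by_contra hcon
    push Not at hcon
    rw [← hcon.1, ← hcon.2] at hx
    simp at hx
  have h3 : n - rho.size = dᶜ.card := by
    rw [Finset.card_compl, Fintype.card_fin]
    omega
  have h4 := Finset.sum_powerset_apply_card (fun j => typeCount rho s t j) (x := dᶜ)
  simp only [smul_eq_mul] at h4
  rw [h1, h2, h3, ← h4]
  -- Sets `u ⊇ d` correspond to subsets `u \ d` of `dᶜ`, which has `n - rho.size` elements; this
  -- yields the binomial coefficients.
  refine Finset.sum_bij' (fun u _ => u \ d) (fun v _ => d ∪ v) ?_ ?_ ?_ ?_ ?_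
  · intro u _
    rw [Finset.mem_powerset]
    exact fun k hk => Finset.mem_compl.2 (Finset.mem_sdiff.1 hk).2
  · intro v _
    simp
  · intro u hu
    exact Finset.union_sdiff_of_subset (Finset.mem_filter.1 hu).2
  · intro v hv
    rw [Finset.mem_powerset] at hv
    exact Finset.union_sdiff_cancel_left
      (Finset.disjoint_right.2 fun k hk => Finset.mem_compl.1 (hv hk))
  · intro u hu
    have hu := (Finset.mem_filter.1 hu).2
    rw [ncard_pairings_disagreement_eq hb h s t hu, Finset.card_sdiff_of_subset hu]
    congr 1
    omega

end PairingCount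
-- The basis of class sums and its structure coefficients.
section Algebra

theorem coeff_classSum {n : ℕ} (lam : ProperPartition) (w : Perm (Fin (2 * n)))
    [Decidable (HasType w lam)] :
    (classSum lam n).coeff w = if HasType w lam then 1 else 0 := by
  classical
  unfold classSum
  rw [MonoidAlgebra.coeff_sum, Finsupp.finsetSum_apply]
  simp only [MonoidAlgebra.of_apply, MonoidAlgebra.coeff_single, Finsupp.single_apply]
  rw [Finset.sum_ite_eq']
  simp only [Finset.mem_filter, Finset.mem_univ, true_and]
  exact if_congr Iff.rfl rfl rfl

theorem coeff_mul_mul_of_mem {n : ℕ} {x : GroupAlg n} (hx : x ∈ heckeAlgebra n)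
    {b b' : Perm (Fin (2 * n))} (hb : b ∈ hyperoctahedral n) (hb' : b' ∈ hyperoctahedral n)
    (w : Perm (Fin (2 * n))) : x.coeff (b * w * b') = x.coeff w := by
  have h := hx b hb b'⁻¹ (inv_mem hb')
  conv_lhs => rw [← h]
  rw [MonoidAlgebra.of_apply, MonoidAlgebra.of_apply, MonoidAlgebra.coeff_mul_single_apply,
    MonoidAlgebra.coeff_single_mul_apply, mul_one, one_mul, inv_inv]
  congr 1
  group

/-- A permutation of a given coset-type. -/
noncomputable def representative {n : ℕ} (s : {s : ProperPartition // s.size ≤ n}) :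
    Perm (Fin (2 * n)) := (exists_perm_hasType s.1 s.2).choose

theorem hasType_representative {n : ℕ} (s : {s : ProperPartition // s.size ≤ n}) :
    HasType (representative s) s.1 := (exists_perm_hasType s.1 s.2).choose_spec

theorem representative_injective (n : ℕ) :
    Function.Injective (representative (n := n)) := fun s s' h =>
  Subtype.ext ((hasType_representative s).unique (h ▸ hasType_representative s'))

instance finite_properPartition (n : ℕ) : Finite {s : ProperPartition // s.size ≤ n} :=
  Finite.of_injective _ (representative_injective n)

theorem coe_sum_smul_K {n : ℕ} [Fintype {s : ProperPartition // s.size ≤ n}]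
    (c : {s : ProperPartition // s.size ≤ n} → ℂ) :
    ((∑ s, c s • K s.1 n : heckeAlgebra n) : GroupAlg n) = ∑ s, c s • classSum s.1 n := by
  rw [AddSubmonoidClass.coe_finsetSum]
  rfl

theorem coeff_sum_smul_K {n : ℕ} [Fintype {s : ProperPartition // s.size ≤ n}]
    (c : {s : ProperPartition // s.size ≤ n} → ℂ) {w : Perm (Fin (2 * n))}
    (s : {s : ProperPartition // s.size ≤ n}) (hw : HasType w s.1) :
    ((∑ s, c s • K s.1 n : heckeAlgebra n) : GroupAlg n).coeff w = c s := by
  classical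
  rw [coe_sum_smul_K, MonoidAlgebra.coeff_sum, Finsupp.finsetSum_apply,
    Finset.sum_eq_single_of_mem s (Finset.mem_univ _)]
  · rw [MonoidAlgebra.coeff_smul_apply, coeff_classSum, if_pos hw, smul_eq_mul, mul_one]
  · intro s' _ hs'
    rw [MonoidAlgebra.coeff_smul_apply, coeff_classSum, if_neg, smul_zero]
    exact fun h => hs' (Subtype.ext (h.unique hw))

/-- An element of the Hecke algebra is determined by its coefficients at representatives of the
coset-types. -/
noncomputable def coeffEquiv (n : ℕ) [Fintype {s : ProperPartition // s.size ≤ n}] :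
    heckeAlgebra n ≃ₗ[ℂ] ({s : ProperPartition // s.size ≤ n} → ℂ) where
  toFun x s := (x : GroupAlg n).coeff (representative s)
  map_add' x y := rfl
  map_smul' c x := rfl
  invFun c := ∑ s, c s • K s.1 n
  left_inv x := by
    apply Subtype.ext
    ext w
    obtain ⟨lam, hw⟩ := exists_hasType_of_perm w
    rw [coeff_sum_smul_K _ ⟨lam, hw.1⟩ hw]
    -- `w` lies in the double coset of the representative of its type, and `x` is constant on double
    -- cosets.
    obtain ⟨b, hb, b', hb', h⟩ := (hasType_representative ⟨lam, hw.1⟩).exists_mul_mul_eq hw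
    exact (coeff_mul_mul_of_mem x.2 hb hb' _).symm.trans (congrArg (x : GroupAlg n).coeff h)
  right_inv c := by
    ext s
    exact coeff_sum_smul_K c s (hasType_representative s)

/-- The basis of the Hecke algebra formed by the elements `K_ρ(n)`. -/
noncomputable def classBasis (n : ℕ) :
    Module.Basis {s : ProperPartition // s.size ≤ n} ℂ (heckeAlgebra n) :=
  letI := Fintype.ofFinite {s : ProperPartition // s.size ≤ n}
  Module.Basis.ofEquivFun (coeffEquiv n)

theorem classBasis_apply (n : ℕ) (s : {s : ProperPartition // s.size ≤ n}) :
    classBasis n s = K s.1 n := by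
  classical
  let _ := Fintype.ofFinite {s : ProperPartition // s.size ≤ n}
  unfold classBasis
  rw [Module.Basis.coe_ofEquivFun]
  change ∑ s', (Pi.single s 1 : _ → ℂ) s' • K s'.1 n = K s.1 n
  rw [Finset.sum_eq_single_of_mem s (Finset.mem_univ _), Pi.single_eq_same, one_smul]
  intro s' _ hs'
  rw [Pi.single_eq_of_ne hs', zero_smul]

theorem classBasis_repr (n : ℕ) (x : heckeAlgebra n)
    (s : {s : ProperPartition // s.size ≤ n}) :
    (classBasis n).repr x s = (x : GroupAlg n).coeff (representative s) := by
  let _ := Fintype.ofFinite {s : ProperPartition // s.size ≤ n}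
  exact Module.Basis.ofEquivFun_repr_apply (coeffEquiv n) x s

theorem coeff_classSum_mul_classSum {n : ℕ} (lam del : ProperPartition)
    (w : Perm (Fin (2 * n))) :
    (classSum lam n * classSum del n).coeff w =
      ({v : Perm (Fin (2 * n)) | HasType v del ∧ HasType (w * v⁻¹) lam}.ncard : ℂ) := by
  classical
  have h1 : classSum del n = ∑ v : Perm (Fin (2 * n)) with HasType v del,
      MonoidAlgebra.of ℂ _ v := by
    unfold classSum
    exact Finset.sum_congr (Finset.filter_congr fun _ _ => Iff.rfl) fun _ _ => rfl
  rw [h1, Finset.mul_sum, MonoidAlgebra.coeff_sum, Finsupp.finsetSum_apply]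
  simp only [MonoidAlgebra.of_apply, MonoidAlgebra.coeff_mul_single_apply, mul_one,
    coeff_classSum]
  rw [Finset.sum_boole, Finset.filter_filter, ← Set.ncard_coe_finset]
  congr 2
  ext v
  simp

theorem cycleType_mul_comm {α : Type*} [Fintype α] [DecidableEq α] (a b : Perm α) :
    (a * b).cycleType = (b * a).cycleType := by
  rw [← Perm.cycleType_conj (σ := b * a) (τ := a)]
  congr 1
  group

/-- Conjugation by `v` carries `interior v` to the block pairing and `interior w` to `interior (w *
v⁻¹)`. -/
theorem hasType_and_hasType_iff {n : ℕ} (lam del : ProperPartition) (w v : Perm (Fin (2 * n))) :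
    HasType v del ∧ HasType (w * v⁻¹) lam ↔
      interior v ∈ pairings (interior w) (2 • del.parts) (2 • lam.parts) := by
  have h : blockSwap n * interior (w * v⁻¹) = v * (interior v * interior w) * v⁻¹ := by
    unfold interior
    group
  rw [hasType_iff, hasType_iff, h, Perm.cycleType_conj, cycleType_mul_comm]
  exact (and_iff_right (isPairing_interior v)).symm

/-- The fibres of `interior` are the cosets `B_n u`, because `B_n` centralizes the block pairing. -/
theorem ncard_interior_eq {n : ℕ} {m : Perm (Fin (2 * n))} (hm : IsPairing m) :
    {v | interior v = m}.ncard = 2 ^ n * n.factorial := by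
  obtain ⟨u, rfl⟩ := exists_interior_eq hm
  have h : {v | interior v = interior u} =
      (fun b => b * u) '' (hyperoctahedral n : Set (Perm (Fin (2 * n)))) := by
    ext v
    constructor
    · intro hv
      refine ⟨v * u⁻¹, ?_, by group⟩
      rw [SetLike.mem_coe, mem_hyperoctahedral_iff]
      have := congrArg (fun x => v * x * u⁻¹) (show v⁻¹ * _ * v = u⁻¹ * _ * u from hv)
      simp only [mul_assoc, mul_inv_cancel_left, mul_inv_cancel, mul_one] at this
      simpa only [mul_assoc] using this.symm
    · rintro ⟨b, hb, rfl⟩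
      rw [SetLike.mem_coe, mem_hyperoctahedral_iff] at hb
      change (b * u)⁻¹ * blockSwap n * (b * u) = u⁻¹ * blockSwap n * u
      rw [mul_inv_rev, mul_assoc, mul_assoc, ← mul_assoc (blockSwap n) b u, ← hb]
      group
  rw [h, Set.ncard_image_of_injective _ (mul_left_injective u), ← Nat.card_coe_set_eq]
  exact card_hyperoctahedral n

theorem ncard_hasType_and_hasType {n : ℕ} (lam del : ProperPartition) (w : Perm (Fin (2 * n))) :
    {v : Perm (Fin (2 * n)) | HasType v del ∧ HasType (w * v⁻¹) lam}.ncard =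
      2 ^ n * n.factorial *
        (pairings (interior w) (2 • del.parts) (2 • lam.parts)).ncard := by
  classical
  simp only [hasType_and_hasType_iff]
  rw [Set.ncard_eq_toFinset_card', Finset.card_eq_sum_card_fiberwise (f := interior)
    (t := (pairings (interior w) (2 • del.parts) (2 • lam.parts)).toFinset)
    (fun v hv => by simpa using hv), Finset.sum_congr rfl (g := fun _ => 2 ^ n * n.factorial),
    Finset.sum_const, smul_eq_mul, mul_comm, Set.ncard_eq_toFinset_card']
  intro m hm
  rw [Set.mem_toFinset] at hm
  rw [← ncard_interior_eq hm.1, ← Set.ncard_coe_finset]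
  congr 1
  ext v
  simp only [Finset.coe_filter, Set.mem_toFinset, Set.mem_ofPred_eq, and_iff_right_iff_imp]
  rintro rfl
  exact hm

theorem structureCoeff_classBasis {n : ℕ} (lam del rho : ProperPartition) (h : rho.size ≤ n) :
    structureCoeff (classBasis n) lam del rho = 2 ^ n * (n.factorial : ℂ) *
      ((∑ j ∈ Finset.range (n - rho.size + 1), (n - rho.size).choose j *
        typeCount rho (2 • del.parts) (2 • lam.parts) j : ℕ) : ℂ) := by
  unfold structureCoeff
  rw [dif_pos h, classBasis_repr]
  change (classSum lam n * classSum del n).coeff _ = _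
  have hw := hasType_representative ⟨rho, h⟩
  rw [hasType_iff] at hw
  rw [coeff_classSum_mul_classSum, ncard_hasType_and_hasType,
    ncard_pairings (isPairing_interior _) hw]
  push_cast
  rfl

/-- Makes the range of summation independent of `n`: the binomial vanishes for `j > m`, and
`typeCount` for `j > |λ| + |δ| - |ρ|`. Truncated subtraction makes the range empty when `|ρ| > |λ| +
|δ|`. -/
theorem sum_range_choose_mul_typeCount (lam del rho : ProperPartition) (m : ℕ) :
    ∑ j ∈ Finset.range (m + 1), m.choose j *
      typeCount rho (2 • del.parts) (2 • lam.parts) j =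
    ∑ j ∈ Finset.range (lam.size + del.size + 1 - rho.size), m.choose j *
      typeCount rho (2 • del.parts) (2 • lam.parts) j := by
  have h1 := Finset.sum_subset (f := fun j => m.choose j *
      typeCount rho (2 • del.parts) (2 • lam.parts) j)
    (Finset.range_mono (le_max_left (m + 1) (lam.size + del.size + 1 - rho.size)))
    (fun j _ hj => by
      rw [Finset.mem_range] at hj
      rw [Nat.choose_eq_zero_of_lt (by omega), zero_mul])
  have h2 := Finset.sum_subset (f := fun j => m.choose j *
      typeCount rho (2 • del.parts) (2 • lam.parts) j)
    (Finset.range_mono (le_max_right (m + 1) (lam.size + del.size + 1 - rho.size)))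
    (fun j _ hj => by
      rw [Finset.mem_range] at hj
      rw [typeCount_eq_zero, mul_zero]
      rw [Multiset.sum_nsmul, Multiset.sum_nsmul, smul_eq_mul, smul_eq_mul,
        ← ProperPartition.size, ← ProperPartition.size]
      omega)
  exact h1.trans h2.symm

end Algebra
end HeckePair

theorem theorem2p1 :
    ∃ B : (n : ℕ) →
        Module.Basis {s : ProperPartition // s.size ≤ n} ℂ (HeckePair.heckeAlgebra n),
      (∀ (n : ℕ) (s : {s : ProperPartition // s.size ≤ n}), B n s = HeckePair.K s.1 n) ∧
      ∀ lam del rho : ProperPartition, ∃ (a : ℕ → ℚ) (f : ℚ[X]),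
        (∀ j, 0 ≤ a j) ∧
        f = ∑ j ∈ Finset.range (lam.size + del.size + 1 - rho.size),
              C (a j) * (descPochhammer ℚ j).comp (X - C (rho.size : ℚ)) ∧
        ∀ n : ℕ,
          (n < rho.size → HeckePair.structureCoeff (B n) lam del rho = 0) ∧
          (rho.size ≤ n → HeckePair.structureCoeff (B n) lam del rho =
            2 ^ n * (n.factorial : ℂ) * ((f.eval (n : ℚ) : ℚ) : ℂ)) := by
  refine ⟨HeckePair.classBasis, HeckePair.classBasis_apply, fun lam del rho =>
    -- The division by `j!` turns `(n-|ρ|).choose j` into the falling factorial `(n-|ρ|)_j`.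
    ⟨fun j => (HeckePair.typeCount rho (2 • del.parts) (2 • lam.parts) j : ℚ) / j.factorial, _,
      fun j => by positivity, rfl, fun n => ⟨fun h => dif_neg (by omega), fun h => ?_⟩⟩⟩
  rw [HeckePair.structureCoeff_classBasis lam del rho h,
    HeckePair.sum_range_choose_mul_typeCount]
  refine congrArg _ ?_
  rw [← Rat.cast_natCast]
  refine congrArg _ ?_
  rw [Nat.cast_sum, eval_finsetSum]
  refine Finset.sum_congr rfl fun j _ => ?_
  rw [eval_mul, eval_C, eval_comp, eval_sub, eval_X, eval_C, ← Nat.cast_sub h,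
    descPochhammer_eval_eq_descFactorial, Nat.descFactorial_eq_factorial_mul_choose]
  have hj : (j.factorial : ℚ) ≠ 0 := Nat.cast_ne_zero.2 (Nat.factorial_ne_zero j)
  push_cast
  field_simp
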